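/- Let $m,n,r$ be nonnegative integers with $0\le r<m$. Let $a_{m,r}(n)$ be the sum, over all partitions $\lambda$ of $n$, of the different parts of $\lambda$ congruent to $r$ modulo $m$ (each such part is counted once for $\lambda$, regardless of its multiplicity). For a partition $\lambda$, let $m_\lambda(1)$ be the number of parts of $\lambda$ equal to $1$, let $w(\lambda)$ be the number of parts of $\lambda$ greater than $m_\lambda(1)$, and define the crank of $\lambda$ by $$cr(\lambda)=\begin{cases}\text{the largest part of }\lambda & \text{if } m_\lambda(1)=0,\\ w(\lambda)-m_\lambda(1) & \text{if } m_\lambda(1)>0,\end{cases}$$ where the largest part of the empty partition is taken to be $0$. Let $C(n)$ be the number of partitions of $n$ with $cr(\lambda)\ge 0$. For $n\ne 1$ let $D(n)$ be the number of partitions of $n$ with $cr(\lambda)>0$, and put $D(1)=1$ (the usual Andrews–Garvan convention $M(-1,1)=M(1,1)=1$, $M(0,1)=-1$ for the crank counts at $n=1$; it gives $C(1)=M(0,1)+M(1,1)=0$, which agrees with the actual count). All of $a_{m,r}$, $C$, $D$ are taken to be $0$ at negative integers. Then (i) $\displaystyle \sum_{j=0}^\infty (-1)^{j}\, a_{m,r}\!\left(n-\frac{j(j+1)}2\right)=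 \sum_{j=0}^\infty (mj+r)\,C(n-mj-r)$; (ii) $\displaystyle \sum_{j=1}^\infty (-1)^{j+1}\, a_{m,r}\!\left(n-\frac{j(j+1)}2\right)= \sum_{j=0}^\infty (mj+r)\,D(n-mj-r)$. -/

import Mathlib

namespace CrankIdentity

/-- The sum, over all partitions of `n`, of the different parts congruent to `r` modulo `m`;
each such part is counted once per partition, regardless of its multiplicity. -/
def residuePartSum (m r n : ℕ) : ℕ :=
  ∑ p : n.Partition, ∑ a ∈ p.parts.toFinset with a ≡ r [MOD m], a

/-- The largest part of a partition (`0` for the empty partition). -/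
def largestPart {n : ℕ} (p : n.Partition) : ℕ := p.parts.sup

/-- The number of parts equal to `1`. -/
def numOnes {n : ℕ} (p : n.Partition) : ℕ := p.parts.count 1

/-- The number of parts (with multiplicity) greater than the number of ones. -/
def numPartsAboveOnes {n : ℕ} (p : n.Partition) : ℕ :=
  (p.parts.filter fun a => numOnes p < a).card

/-- The crank of a partition. -/
def crank {n : ℕ} (p : n.Partition) : ℤ :=
  if numOnes p = 0 then (largestPart p : ℤ)
  else (numPartsAboveOnes p : ℤ) - (numOnes p : ℤ)

/-- `C(n)`: the number of partitions of `n` with nonnegative crank. -/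
def nonnegCrankCount (n : ℕ) : ℕ :=
  (Finset.univ.filter fun p : n.Partition => 0 ≤ crank p).card

/-- `D(n)`: the number of partitions of `n` with positive crank, with the Andrews–Garvan convention
for `n = 1`. That convention assigns to `n = 1` the crank counts `M(-1,1) = M(1,1) = 1`,
`M(0,1) = -1`, and `M(k,1) = 0` otherwise, so that `D(1) = 1`; it leaves `C(1) = 1 - 1 = 0`
equal to the actual number of partitions of `1` with nonnegative crank. -/
def posCrankCount (n : ℕ) : ℕ :=
  if n = 1 then 1
  else (Finset.univ.filter fun p : n.Partition => 0 < crank p).card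

/-- The extension of a counting function to all integers by `0` at negative arguments. -/
def atInt (f : ℕ → ℕ) (x : ℤ) : ℤ := if 0 ≤ x then (f x.toNat : ℤ) else 0

end CrankIdentity

/-!
Write `p(n)` for the number of partitions of `n`, and `T j = j (j + 1) / 2`. A part `a ≥ 1` occurs
in `p(n - a)` partitions of `n`, so that `a_{m,r}(n) = ∑ i, (m i + r) p(n - m i - r)`
(`atInt_residuePartSum`). By linearity both identities follow from the two formulas
`C(n) = ∑ j ≥ 0, (-1)^j p(n - T j)` and `C(n) + D(n) = p(n)`.

Describe a partition by its conjugate `f`, where `f i` is the number of parts exceeding `i`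
(`shape`). With `k = f 0 - f 1` ones, the crank is nonnegative iff `f k ≥ k`, and positive iff
`f k ≥ k + 1`. Let `t_s(n)` be the number of `f` of size `n` such that `f d = d + s` for some `d`
(`meetCount`). Two bijections give the formulas.

* For `s = 0` and `s = 1`, the number of `f` with `f k ≥ k + s` is `t_s(n)`, except for `s = n = 1`
  (`card_onesBound_eq_card_meetsDiag`). If `d` is the largest index with `f d ≥ d + s`, the
  condition is `k ≤ d`. Replacing the surplus `f d - (d + s)` of parts `d + 1` by `d + 1` ones each
  makes `f d = d + s`; dividing the number of ones by `d + 1` undoes this. Hence `C = t_0` and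
  `D = t_1`, the convention `D(1) = 1` repairing the exceptional case.
* `t_s(n + s) = p(n) - t_{s+1}(n)` (`card_meetsDiag_shift`). An antitone sequence `f` corresponds to
  the set of the distinct integers `f i - i`; removing `s` from a set that contains it and adding
  `1` to the other elements yields exactly the sets without `s + 1`.

The case `s = 0` of the recurrence is `C(n) + D(n) = p(n)`, and its iteration is the
formula for `C`.
-/

namespace CrankIdentity

/-! ### Partitions as antitone sequences -/

/-- `f` is the sequence of column lengths of a Young diagram with `n` cells: an antitone sequence,
indexed from `0`, that vanishes eventually and has sum `n`. The cut-off `n` is large enough, since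
a sequence with nonzero `n`-th term has sum at least `n + 1`. -/
structure IsShape (n : ℕ) (f : ℕ → ℕ) : Prop where
  anti : Antitone f
  apply_eq_zero : f n = 0
  sum_eq : ∑ i ∈ Finset.range n, f i = n

namespace IsShape

variable {n : ℕ} {f : ℕ → ℕ}

theorem eq_zero_of_le (h : IsShape n f) {i : ℕ} (hi : n ≤ i) : f i = 0 :=
  Nat.le_zero.1 (h.apply_eq_zero ▸ h.anti hi)

theorem sum_range_eq (h : IsShape n f) {N : ℕ} (hN : n ≤ N) :
    ∑ i ∈ Finset.range N, f i = n := by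
  rw [← Finset.sum_range_add_sum_Ico _ hN, h.sum_eq, Finset.sum_eq_zero, add_zero]
  intro i hi
  exact h.eq_zero_of_le (Finset.mem_Ico.1 hi).1

theorem of_sum_range (hf : Antitone f) {N : ℕ} (hN : f N = 0)
    (hs : ∑ i ∈ Finset.range N, f i = n) : IsShape n f := by
  have h0 : ∀ i, N ≤ i → f i = 0 := fun i hi => Nat.le_zero.1 (hN ▸ hf hi)
  have hn : f n = 0 := by
    by_contra hne
    have hlt : n < N := by
      by_contra hge
      exact hne (h0 n (not_lt.1 hge))
    have h1 : ∑ i ∈ Finset.range (n + 1), 1 ≤ ∑ i ∈ Finset.range (n + 1), f i :=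
      Finset.sum_le_sum fun i hi =>
        (Nat.one_le_iff_ne_zero.2 hne).trans (hf (Nat.lt_succ_iff.1 (Finset.mem_range.1 hi)))
    have h2 : ∑ i ∈ Finset.range (n + 1), f i ≤ ∑ i ∈ Finset.range N, f i :=
      Finset.sum_le_sum_of_subset (Finset.range_subset_range.2 hlt)
    simp only [Finset.sum_const, Finset.card_range, smul_eq_mul, mul_one] at h1
    omega
  refine ⟨hf, hn, ?_⟩
  rcases le_total n N with h | h
  · rw [← Finset.sum_range_add_sum_Ico f h, Finset.sum_eq_zero (s := Finset.Ico n N),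
      add_zero] at hs
    · exact hs
    · exact fun i hi => Nat.le_zero.1 (hn ▸ hf (Finset.mem_Ico.1 hi).1)
  · rw [← Finset.sum_range_add_sum_Ico f h, hs, Finset.sum_eq_zero, add_zero]
    exact fun i hi => h0 i (Finset.mem_Ico.1 hi).1

end IsShape

/-- The conjugate of a partition, indexed from `0`: `shape p i` is the number of parts of `p`
(with multiplicity) that exceed `i`. -/
def shape {n : ℕ} (p : n.Partition) (i : ℕ) : ℕ := p.parts.countP (i < ·)

theorem sum_range_countP_lt (s : Multiset ℕ) {N : ℕ} (hN : ∀ a ∈ s, a ≤ N) :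
    ∑ i ∈ Finset.range N, s.countP (i < ·) = s.sum := by
  induction s using Multiset.induction_on with
  | empty => simp
  | cons a s ih =>
    have ha : a ≤ N := hN a (Multiset.mem_cons_self a s)
    have hcard : ∑ i ∈ Finset.range N, (if i < a then 1 else 0) = a := by
      rw [← Finset.card_filter]
      have : {i ∈ Finset.range N | i < a} = Finset.range a := by
        ext i
        simp only [Finset.mem_filter, Finset.mem_range]
        omega
      rw [this, Finset.card_range]
    simp only [Multiset.countP_cons, Finset.sum_add_distrib, Multiset.sum_cons, hcard]
    rw [ih fun b hb => hN b (Multiset.mem_cons_of_mem hb), add_comm]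

theorem countP_lt_eq_count_add (s : Multiset ℕ) (i : ℕ) :
    s.countP (i < ·) = s.count (i + 1) + s.countP (i + 1 < ·) := by
  induction s using Multiset.induction_on with
  | empty => simp
  | cons a s ih =>
    simp only [Multiset.countP_cons, Multiset.count_cons, ih]
    split_ifs <;> omega

theorem part_le {n : ℕ} (p : n.Partition) {a : ℕ} (ha : a ∈ p.parts) : a ≤ n :=
  p.parts_sum ▸ Multiset.le_sum_of_mem ha

theorem isShape_shape {n : ℕ} (p : n.Partition) : IsShape n (shape p) := by
  refine ⟨antitone_nat_of_succ_le fun i => ?_, ?_, ?_⟩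
  · exact (Nat.le_add_left _ _).trans_eq (countP_lt_eq_count_add p.parts i).symm
  · exact Multiset.countP_eq_zero.2 fun a ha => not_lt.2 (part_le p ha)
  · exact (sum_range_countP_lt p.parts fun a ha => part_le p ha).trans p.parts_sum

theorem shape_injective {n : ℕ} : Function.Injective (shape (n := n)) := by
  intro p q h
  have h' : ∀ i, p.parts.countP (i < ·) = q.parts.countP (i < ·) := congrFun h
  ext a
  cases a with
  | zero =>
    rw [Multiset.count_eq_zero_of_notMem fun h0 => (p.parts_pos h0).ne' rfl,
      Multiset.count_eq_zero_of_notMem fun h0 => (q.parts_pos h0).ne' rfl]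
  | succ i =>
    have h1 := countP_lt_eq_count_add p.parts i
    have h2 := countP_lt_eq_count_add q.parts i
    rw [h' i, h' (i + 1)] at h1
    omega

/-- The partition with conjugate `f` has `f i - f (i + 1)` parts equal to `i + 1`. -/
theorem exists_shape_eq {n : ℕ} {f : ℕ → ℕ} (hf : IsShape n f) :
    ∃ p : n.Partition, shape p = f := by
  set s : Multiset ℕ :=
    ∑ i ∈ Finset.range n, Multiset.replicate (f i - f (i + 1)) (i + 1) with hs
  have hmem : ∀ a ∈ s, 0 < a ∧ a ≤ n := by
    intro a ha
    obtain ⟨i, hi, hai⟩ := Multiset.mem_sum.1 ha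
    rw [Multiset.eq_of_mem_replicate hai]
    exact ⟨i.succ_pos, Finset.mem_range.1 hi⟩
  have hcount : ∀ i, s.count (i + 1) = f i - f (i + 1) := by
    intro i
    rw [hs, Multiset.count_sum']
    simp only [Multiset.count_replicate, Nat.add_right_cancel_iff]
    rw [Finset.sum_ite_eq']
    split_ifs with h
    · rfl
    · rw [hf.eq_zero_of_le (not_lt.1 fun h' => h (Finset.mem_range.2 h')), Nat.zero_sub]
  have htail : ∀ j i, n ≤ i + j → s.countP (i < ·) = f i := by
    intro j
    induction j with
    | zero =>
      intro i hi
      rw [hf.eq_zero_of_le (i := i) hi]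
      exact Multiset.countP_eq_zero.2 fun a ha => not_lt.2 ((hmem a ha).2.trans hi)
    | succ j ih =>
      intro i hi
      rw [countP_lt_eq_count_add, hcount, ih (i + 1) (by omega)]
      exact Nat.sub_add_cancel (hf.anti i.le_succ)
  have hshape : ∀ i, s.countP (i < ·) = f i := fun i => htail n i (Nat.le_add_left n i)
  refine ⟨⟨s, fun {a} ha => (hmem a ha).1, ?_⟩, funext hshape⟩
  rw [← sum_range_countP_lt s fun a ha => (hmem a ha).2]
  simp only [hshape]
  exact hf.sum_eq

theorem card_filter_shape (n : ℕ) (P : (ℕ → ℕ) → Prop)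
    [DecidablePred fun p : n.Partition => P (shape p)] :
    (Finset.univ.filter fun p : n.Partition => P (shape p)).card
      = Nat.card {f : ℕ → ℕ // IsShape n f ∧ P f} := by
  rw [← Fintype.card_subtype, ← Nat.card_eq_fintype_card]
  refine Nat.card_congr (Equiv.ofBijective
    (fun p => ⟨shape p.1, isShape_shape p.1, p.2⟩) ⟨?_, ?_⟩)
  · intro p q h
    exact Subtype.ext (shape_injective (congrArg Subtype.val h))
  · rintro ⟨f, hf, hP⟩
    obtain ⟨p, rfl⟩ := exists_shape_eq hf
    exact ⟨⟨p, hP⟩, rfl⟩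

/-- If `P` and `Q` are disjoint unions, over the same index set, of `R d` and `S d`, then bijections
between the pieces `R d` and `S d` show that `P` and `Q` have the same cardinality. -/
theorem card_exists_congr {P Q : (ℕ → ℕ) → Prop} {R S : ℕ → (ℕ → ℕ) → Prop}
    (hP : ∀ f, P f ↔ ∃ d, R d f) (hQ : ∀ f, Q f ↔ ∃ d, S d f)
    (hR : ∀ f d e, R d f → R e f → d = e) (hS : ∀ f d e, S d f → S e f → d = e)
    (e : ∀ d, {f // R d f} ≃ {f // S d f}) :
    Nat.card {f // P f} = Nat.card {f // Q f} := by
  have key : ∀ {P : (ℕ → ℕ) → Prop} {R : ℕ → (ℕ → ℕ) → Prop}, (∀ f, P f ↔ ∃ d, R d f) →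
      (∀ f d e, R d f → R e f → d = e) → Nat.card {f // P f} = Nat.card (Σ d, {f // R d f}) := by
    intro P R hP hR
    refine (Nat.card_congr (Equiv.ofBijective
      (fun x => ⟨x.2.1, (hP _).2 ⟨x.1, x.2.2⟩⟩) ⟨?_, ?_⟩)).symm
    · rintro ⟨d, f, hf⟩ ⟨e, g, hg⟩ h
      obtain rfl : f = g := congrArg Subtype.val h
      obtain rfl := hR f d e hf hg
      rfl
    · rintro ⟨f, hf⟩
      obtain ⟨d, hd⟩ := (hP f).1 hf
      exact ⟨⟨d, f, hd⟩, rfl⟩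
  rw [key hP hR, key hQ hS]
  exact Nat.card_congr (Equiv.sigmaCongrRight e)

/-! ### Shifting the diagonal -/

/-- The sequence `f` meets the diagonal `d ↦ d + s`. For antitone `f` this happens for at most one
`d`. -/
def MeetsDiag (s : ℕ) (f : ℕ → ℕ) : Prop := ∃ d, f d = d + s

theorem eq_of_apply_eq_add {f : ℕ → ℕ} (hf : Antitone f) {s d e : ℕ} (hd : f d = d + s)
    (he : f e = e + s) : d = e := by
  rcases le_total d e with h | h <;> have := hf h <;> omega

/-- Delete the term with index `d` and increase all the earlier terms by `1`. In terms of the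
strictly decreasing sequence `f i - i`, one value is removed and the others are increased by `1`. -/
def shiftDown (d : ℕ) (f : ℕ → ℕ) (i : ℕ) : ℕ := if i < d then f i + 1 else f (i + 1)

/-- The inverse of `shiftDown`: decrease the first `d` terms by `1` and insert the term `d + s` at
index `d`. -/
def shiftUp (s d : ℕ) (f : ℕ → ℕ) (i : ℕ) : ℕ :=
  if i < d then f i - 1 else if i = d then d + s else f (i - 1)

theorem isShape_shiftDown {n s d : ℕ} {f : ℕ → ℕ} (hf : IsShape (n + s) f) (hd : f d = d + s) :
    IsShape n (shiftDown d f) := by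
  set N := n + s + d + 1 with hN
  refine IsShape.of_sum_range (N := N) (antitone_nat_of_succ_le fun i => ?_) ?_ ?_
  · have h1 := hf.anti (Nat.le_succ i)
    have h2 := hf.anti (Nat.le_succ (i + 1))
    simp only [shiftDown, Nat.succ_eq_add_one] at *
    split_ifs <;> omega
  · rw [shiftDown, if_neg (by omega)]
    exact hf.eq_zero_of_le (by omega)
  · have h1 := hf.sum_range_eq (N := d + 1 + (N - d)) (by omega)
    rw [Finset.sum_range_add, Finset.sum_range_succ, hd] at h1
    have h2 : ∑ i ∈ Finset.range N, shiftDown d f i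
        = ∑ i ∈ Finset.range d, (f i + 1) + ∑ i ∈ Finset.range (N - d), f (d + 1 + i) := by
      rw [show N = d + (N - d) by omega, Finset.sum_range_add]
      congr 1
      · exact Finset.sum_congr rfl fun i hi => if_pos (Finset.mem_range.1 hi)
      · rw [Nat.add_sub_cancel_left]
        refine Finset.sum_congr rfl fun i _ => ?_
        rw [shiftDown, if_neg (by omega)]
        congr 1
        omega
    rw [h2, Finset.sum_add_distrib]
    simp only [Finset.sum_const, Finset.card_range, smul_eq_mul, mul_one]
    omega

theorem isShape_shiftUp {n s d : ℕ} {f : ℕ → ℕ} (hf : IsShape n f) (hd : f d ≤ d + s)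
    (hlt : ∀ i < d, d + s + 1 ≤ f i) : IsShape (n + s) (shiftUp s d f) := by
  set N := n + s + d + 1 with hN
  refine IsShape.of_sum_range (N := d + 1 + N) (antitone_nat_of_succ_le fun i => ?_) ?_ ?_
  · have h1 := hf.anti (Nat.le_succ i)
    have h2 := hf.anti (Nat.sub_le i 1)
    have h3 := hlt i
    have h4 : i = d → f i ≤ d + s := fun h => h ▸ hd
    simp only [shiftUp, Nat.succ_eq_add_one, Nat.add_sub_cancel] at *
    split_ifs <;> omega
  · rw [shiftUp, if_neg (by omega), if_neg (by omega)]
    exact hf.eq_zero_of_le (by omega)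
  · have h1 := hf.sum_range_eq (N := d + N) (by omega)
    rw [Finset.sum_range_add] at h1
    have h2 : ∑ i ∈ Finset.range (d + 1 + N), shiftUp s d f i
        = ∑ i ∈ Finset.range d, (f i - 1) + (d + s) + ∑ i ∈ Finset.range N, f (d + i) := by
      rw [Finset.sum_range_add, Finset.sum_range_succ]
      congr 1
      · congr 1
        · exact Finset.sum_congr rfl fun i hi => if_pos (Finset.mem_range.1 hi)
        · rw [shiftUp, if_neg (lt_irrefl d), if_pos rfl]
      · refine Finset.sum_congr rfl fun i _ => ?_
        rw [shiftUp, if_neg (by omega), if_neg (by omega)]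
        congr 1
        omega
    have h3 : ∑ i ∈ Finset.range d, f i = ∑ i ∈ Finset.range d, (f i - 1) + d := by
      have h4 : ∑ i ∈ Finset.range d, f i = ∑ i ∈ Finset.range d, (f i - 1 + 1) :=
        Finset.sum_congr rfl fun i hi => by have := hlt i (Finset.mem_range.1 hi); omega
      rw [h4, Finset.sum_add_distrib]
      simp
    rw [h2]
    omega

/-- The values `f i - i` are distinct, and `shiftDown` removes the value `s` from their set and then
increases the others by `1`. The result is an arbitrary set not containing `s + 1`. The
term `d + s` is lost and `d` is gained, so the size drops by `s`. -/
theorem card_meetsDiag_shift (n s : ℕ) :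
    Nat.card {f : ℕ → ℕ // IsShape (n + s) f ∧ MeetsDiag s f}
      = Nat.card {f : ℕ → ℕ // IsShape n f ∧ ¬ MeetsDiag (s + 1) f} := by
  refine card_exists_congr (R := fun d f => IsShape (n + s) f ∧ f d = d + s)
    (S := fun d f => IsShape n f ∧ f d ≤ d + s ∧ ∀ i < d, d + s + 1 ≤ f i)
    (fun f => ⟨fun ⟨hf, d, hd⟩ => ⟨d, hf, hd⟩, fun ⟨d, hf, hd⟩ => ⟨hf, d, hd⟩⟩) (fun f => ?_)
    (fun f d e hd he => eq_of_apply_eq_add hd.1.anti hd.2 he.2) (fun f d e hd he => ?_)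
    (fun d => ⟨fun f => ⟨shiftDown d f.1, isShape_shiftDown f.2.1 f.2.2, ?_, ?_⟩,
      fun f => ⟨shiftUp s d f.1, isShape_shiftUp f.2.1 f.2.2.1 f.2.2.2, ?_⟩, ?_, ?_⟩)
  · constructor
    · rintro ⟨hf, hne⟩
      have hex : ∃ d, f d ≤ d + s := ⟨n, by rw [hf.apply_eq_zero]; exact Nat.zero_le _⟩
      classical
      refine ⟨Nat.find hex, hf, Nat.find_spec hex, ?_⟩
      intro i hi
      -- At the index before the crossing, `f` exceeds the diagonal by one more, as it is not on it.
      have h1 := Nat.find_min hex (m := Nat.find hex - 1) (by omega)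
      have h2 : f (Nat.find hex - 1) ≠ Nat.find hex - 1 + (s + 1) := fun h => hne ⟨_, h⟩
      have h3 := hf.anti (show i ≤ Nat.find hex - 1 by omega)
      omega
    · rintro ⟨d, hf, hd, hlt⟩
      refine ⟨hf, fun ⟨e, he⟩ => ?_⟩
      rcases lt_or_ge e d with h | h
      · have := hlt e h
        omega
      · have := hf.anti h
        omega
  · rcases lt_trichotomy d e with h | h | h
    · have := he.2.2 d h
      have := hd.2.1
      omega
    · exact h
    · have := hd.2.2 e h
      have := he.2.1
      omega
  · have := f.2.1.anti (Nat.le_succ d)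
    rw [shiftDown, if_neg (lt_irrefl d)]
    exact this.trans_eq f.2.2
  · intro i hi
    have := f.2.1.anti hi.le
    rw [shiftDown, if_pos hi]
    have := f.2.2
    omega
  · rw [shiftUp, if_neg (lt_irrefl d), if_pos rfl]
  · rintro ⟨f, hf, hd⟩
    refine Subtype.ext (funext fun i => ?_)
    simp only [shiftUp, shiftDown]
    rcases lt_trichotomy i d with h | rfl | h
    · simp [h]
    · simp [hd]
    · rw [if_neg (by omega), if_neg (by omega), if_neg (by omega)]
      congr 1
      omega
  · rintro ⟨f, hf, hd, hlt⟩
    refine Subtype.ext (funext fun i => ?_)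
    simp only [shiftUp, shiftDown]
    rcases lt_or_ge i d with h | h
    · have := hlt i h
      rw [if_pos h, if_pos h]
      omega
    · rw [if_neg (by omega), if_neg (by omega), if_neg (by omega), Nat.add_sub_cancel]

/-! ### Trading parts for ones -/

/-- On conjugates, the operation that replaces `c = f d - (d + s)` parts equal to `d + 1` by
`c * (d + 1)` parts equal to `1`: the number of parts exceeding `i` falls by `c` for `1 ≤ i ≤ d`,
and the number of all parts grows by `c * d`. -/
def splitToOnes (s d : ℕ) (f : ℕ → ℕ) (i : ℕ) : ℕ :=
  if i = 0 then f 0 + d * (f d - (d + s)) else if i ≤ d then f i - (f d - (d + s)) else f i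

/-- The inverse of `splitToOnes`: there are `f 0 - f 1` ones, and as many groups of `d + 1` of them
as possible are each replaced by one part `d + 1`. -/
def mergeOnes (d : ℕ) (f : ℕ → ℕ) (i : ℕ) : ℕ :=
  if i = 0 then f 0 - d * ((f 0 - f 1) / (d + 1))
  else if i ≤ d then f i + (f 0 - f 1) / (d + 1) else f i

/-- Moving `c` units from each of the terms with indices `1, …, d` to the term with index `0`
preserves the sum. -/
theorem sum_range_eq_of_transfer {f g : ℕ → ℕ} {d c N : ℕ} (h0 : g 0 = f 0 + d * c)
    (hle : ∀ i < d, f (i + 1) = g (i + 1) + c) (hgt : ∀ i, d < i → f i = g i) (hN : d < N) :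
    ∑ i ∈ Finset.range N, f i = ∑ i ∈ Finset.range N, g i := by
  obtain ⟨M, rfl⟩ := Nat.exists_eq_add_of_le (show d + 1 ≤ N from hN)
  rw [Finset.sum_range_add f, Finset.sum_range_add g, Finset.sum_range_succ' f,
    Finset.sum_range_succ' g,
    h0, Finset.sum_congr rfl fun i hi => hle i (Finset.mem_range.1 hi),
    Finset.sum_congr rfl fun i (_ : i ∈ Finset.range M) => hgt (d + 1 + i) (by omega),
    Finset.sum_add_distrib, Finset.sum_const, Finset.card_range, smul_eq_mul]
  ring

theorem isShape_splitToOnes {n s d : ℕ} {f : ℕ → ℕ} (hf : IsShape n f) (hd : d + s ≤ f d)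
    (hd' : f (d + 1) ≤ d + s) : IsShape n (splitToOnes s d f) := by
  refine IsShape.of_sum_range (N := n + d + 1) (antitone_nat_of_succ_le fun i => ?_) ?_ ?_
  · have h1 := hf.anti (Nat.le_succ i)
    have h2 : i = d → f i = f d ∧ f (i + 1) ≤ d + s := by rintro rfl; exact ⟨rfl, hd'⟩
    have h3 : d = 0 → f 0 = f d := by rintro rfl; rfl
    have h4 : i = 0 → f i = f 0 := by rintro rfl; rfl
    simp only [splitToOnes, Nat.succ_eq_add_one, Nat.succ_ne_zero, ↓reduceIte] at *
    generalize d * (f d - (d + s)) = z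
    split_ifs <;> omega
  · rw [splitToOnes, if_neg (by omega), if_neg (by omega)]
    exact hf.eq_zero_of_le (by omega)
  · rw [← sum_range_eq_of_transfer (f := f) (d := d) (c := f d - (d + s)) ?_ ?_ ?_ (by omega)]
    · exact hf.sum_range_eq (by omega)
    · rw [splitToOnes, if_pos rfl]
    · intro i hi
      have := hf.anti (show i + 1 ≤ d from hi)
      rw [splitToOnes, if_neg (by omega), if_pos (by omega)]
      omega
    · intro i hi
      rw [splitToOnes, if_neg (by omega), if_neg (by omega)]

theorem mergeOnes_quotient_le (d : ℕ) (f : ℕ → ℕ) :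
    d * ((f 0 - f 1) / (d + 1)) + (f 0 - f 1) / (d + 1) ≤ f 0 - f 1 :=
  (Nat.succ_mul _ _).symm.trans_le (Nat.mul_div_le _ _)

theorem isShape_mergeOnes {n d : ℕ} {f : ℕ → ℕ} (hf : IsShape n f) :
    IsShape n (mergeOnes d f) := by
  have hc := mergeOnes_quotient_le d f
  refine IsShape.of_sum_range (N := n + d + 1) (antitone_nat_of_succ_le fun i => ?_) ?_ ?_
  · have h1 := hf.anti (Nat.le_succ i)
    have h2 := hf.anti zero_le_one
    have h3 : d = 0 → d * ((f 0 - f 1) / (d + 1)) = 0 := by rintro rfl; exact Nat.zero_mul _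
    have h4 : i = 0 → f i = f 0 ∧ f (i + 1) = f 1 := by rintro rfl; exact ⟨rfl, rfl⟩
    simp only [mergeOnes, Nat.succ_eq_add_one, Nat.succ_ne_zero, ↓reduceIte] at *
    generalize d * ((f 0 - f 1) / (d + 1)) = z at *
    generalize (f 0 - f 1) / (d + 1) = c at *
    split_ifs <;> omega
  · rw [mergeOnes, if_neg (by omega), if_neg (by omega)]
    exact hf.eq_zero_of_le (by omega)
  · rw [sum_range_eq_of_transfer (g := f) (d := d) (c := (f 0 - f 1) / (d + 1)) ?_ ?_ ?_ (by omega)]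
    · exact hf.sum_range_eq (by omega)
    · rw [mergeOnes, if_pos rfl]
      exact (Nat.sub_add_cancel (by
        generalize (f 0 - f 1) / (d + 1) = c at *
        generalize d * c = z at *
        omega)).symm
    · intro i hi
      rw [mergeOnes, if_neg (by omega), if_pos (by omega)]
    · intro i hi
      rw [mergeOnes, if_neg (by omega), if_neg (by omega)]

theorem apply_one_of_apply_zero_eq_one {n : ℕ} {f : ℕ → ℕ} (hf : IsShape n f) (hn : n ≠ 1)
    (h0 : f 0 = 1) : f 1 = 1 := by
  have h1 := hf.anti zero_le_one
  by_contra h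
  have h2 : f 1 = 0 := by omega
  have h3 := hf.sum_eq
  have h4 : ∀ i, i ≠ 0 → f i = 0 := fun i hi =>
    Nat.le_zero.1 (h2 ▸ hf.anti (Nat.one_le_iff_ne_zero.2 hi))
  cases n with
  | zero => exact absurd hf.apply_eq_zero (by omega)
  | succ n =>
    rw [Finset.sum_range_succ', Finset.sum_eq_zero fun i _ => h4 (i + 1) i.succ_ne_zero] at h3
    omega

/-- Let `k = f 0 - f 1` be the number of ones. The inequality `k + s ≤ f k` says that `k ≤ d`, where
`d` is the largest index with `d + s ≤ f d`. Trading the surplus parts `d + 1` for ones turns `f d`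
into `d + s`, and the number of ones into `k` plus a multiple of `d + 1`; division with remainder by
`d + 1` recovers `k ≤ d`. For `d = 0` there is nothing to trade, and what has to be checked is that
a partition with exactly `s` parts has no part `1`; this fails only for the partition `1` of `1`,
with `s = 1`. -/
theorem card_onesBound_eq_card_meetsDiag {n s : ℕ} (hs : s = 0 ∨ s = 1 ∧ n ≠ 1) :
    Nat.card {f : ℕ → ℕ // IsShape n f ∧ f 0 - f 1 + s ≤ f (f 0 - f 1)}
      = Nat.card {f : ℕ → ℕ // IsShape n f ∧ MeetsDiag s f} := by
  refine card_exists_congr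
    (R := fun d f => IsShape n f ∧ d + s ≤ f d ∧ f (d + 1) ≤ d + s ∧ f 0 - f 1 ≤ d)
    (S := fun d f => IsShape n f ∧ f d = d + s) (fun f => ?_)
    (fun f => ⟨fun ⟨hf, d, hd⟩ => ⟨d, hf, hd⟩, fun ⟨d, hf, hd⟩ => ⟨hf, d, hd⟩⟩)
    (fun f d e hd he => ?_) (fun f d e hd he => eq_of_apply_eq_add hd.1.anti hd.2 he.2)
    (fun d => ⟨fun f => ⟨splitToOnes s d f.1, isShape_splitToOnes f.2.1 f.2.2.1 f.2.2.2.1, ?_⟩,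
      fun f => ⟨mergeOnes d f.1, isShape_mergeOnes f.2.1, ?_, ?_, ?_⟩, ?_, ?_⟩)
  · constructor
    · rintro ⟨hf, hk⟩
      have hex : ∃ d, f (d + 1) ≤ d + s := ⟨n, by rw [hf.eq_zero_of_le n.le_succ]; omega⟩
      classical
      refine ⟨Nat.find hex, hf, ?_, Nat.find_spec hex, ?_⟩
      · rcases Nat.eq_zero_or_pos (Nat.find hex) with h | h
        · rw [h]
          have := hf.anti (Nat.zero_le (f 0 - f 1))
          omega
        · have := Nat.find_min hex (m := Nat.find hex - 1) (by omega)
          rw [Nat.sub_add_cancel h] at this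
          omega
      · by_contra h
        have h1 := hf.anti (show Nat.find hex + 1 ≤ f 0 - f 1 by omega)
        have h2 := Nat.find_spec hex
        omega
    · rintro ⟨d, hf, hd, -, hk⟩
      have := hf.anti hk
      exact ⟨hf, by omega⟩
  · rcases lt_trichotomy d e with h | h | h
    · have := hd.1.anti (show d + 1 ≤ e from h)
      omega
    · exact h
    · have := hd.1.anti (show e + 1 ≤ d from h)
      omega
  · obtain ⟨f, hf, hd, hd', hk⟩ := f
    simp only [splitToOnes]
    rcases Nat.eq_zero_or_pos d with rfl | h
    · simp at *
      omega
    · rw [if_neg (by omega), if_pos le_rfl]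
      omega
  · obtain ⟨f, hf, hd⟩ := f
    simp only [mergeOnes, le_refl, if_true]
    split_ifs with h
    · subst h
      simp [hd]
    · exact hd.symm.trans_le (Nat.le_add_right _ _)
  · obtain ⟨f, hf, hd⟩ := f
    have := hf.anti d.le_succ
    simp only [mergeOnes, if_neg d.succ_ne_zero, if_neg (show ¬ d + 1 ≤ d by omega)]
    exact this.trans_eq hd
  · obtain ⟨f, hf, hd⟩ := f
    simp only [mergeOnes]
    rcases Nat.eq_zero_or_pos d with rfl | h
    · have h1 := hf.anti zero_le_one
      have h2 : s = 1 → f 1 = 1 := fun h => by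
        subst h
        exact apply_one_of_apply_zero_eq_one hf (by omega) (by omega)
      simp
      omega
    · have h1 := Nat.mod_lt (f 0 - f 1) d.succ_pos
      have h2 := Nat.div_add_mod (f 0 - f 1) (d + 1)
      rw [Nat.succ_eq_add_one] at h1
      rw [Nat.succ_mul] at h2
      simp only [one_ne_zero, ↓reduceIte, show 1 ≤ d from h]
      generalize (f 0 - f 1) / (d + 1) = c at *
      generalize d * c = z at *
      omega
  · rintro ⟨f, hf, hd, hd', hk⟩
    refine Subtype.ext (funext fun i => ?_)
    -- For `d = 0` there are no ones, and no parts are traded.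
    have hq : (splitToOnes s d f 0 - splitToOnes s d f 1) / (d + 1)
        = if d = 0 then 0 else f d - (d + s) := by
      rcases Nat.eq_zero_or_pos d with rfl | h
      · simp [splitToOnes]
        omega
      · have h1 := hf.anti (show 1 ≤ d from h)
        have h2 := hf.anti zero_le_one
        rw [if_neg (by omega)]
        simp only [splitToOnes, if_true, if_neg one_ne_zero, if_pos (show 1 ≤ d from h)]
        rw [show f 0 + d * (f d - (d + s)) - (f 1 - (f d - (d + s)))
          = f 0 - f 1 + (d + 1) * (f d - (d + s)) by rw [Nat.succ_mul]; omega,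
          Nat.add_mul_div_left _ _ d.succ_pos, Nat.div_eq_of_lt (by omega), Nat.zero_add]
    have hi : i ≤ d → f d ≤ f i := fun h => hf.anti h
    simp only [mergeOnes, hq]
    simp only [splitToOnes]
    split_ifs <;> simp_all <;> omega
  · rintro ⟨f, hf, hd⟩
    refine Subtype.ext (funext fun i => ?_)
    have hc := mergeOnes_quotient_le d f
    have hq : d ≠ 0 → mergeOnes d f d - (d + s) = (f 0 - f 1) / (d + 1) := fun h => by
      simp only [mergeOnes, if_neg h, if_pos le_rfl, hd, Nat.add_sub_cancel_left]
    simp only [splitToOnes]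
    rcases Nat.eq_zero_or_pos d with rfl | h
    · simp +contextual [mergeOnes]
    · rw [hq h.ne']
      simp only [mergeOnes]
      generalize (f 0 - f 1) / (d + 1) = c at *
      generalize d * c = z at *
      split_ifs <;> simp_all <;> omega

/-! ### Counting by the crank -/

open scoped Classical in
/-- The number of partitions of `n` whose conjugate meets the diagonal `d ↦ d + s`. -/
noncomputable def meetCount (s n : ℕ) : ℕ :=
  (Finset.univ.filter fun p : n.Partition => MeetsDiag s (shape p)).card

theorem numOnes_eq {n : ℕ} (p : n.Partition) : numOnes p = shape p 0 - shape p 1 := by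
  have := countP_lt_eq_count_add p.parts 0
  simp only [numOnes, shape, Nat.zero_add] at *
  omega

theorem numPartsAboveOnes_eq {n : ℕ} (p : n.Partition) :
    numPartsAboveOnes p = shape p (numOnes p) :=
  (Multiset.countP_eq_card_filter _ _).symm

/-- In the absence of ones both sides hold. -/
theorem crank_nonneg_iff {n : ℕ} (p : n.Partition) :
    0 ≤ crank p ↔ shape p 0 - shape p 1 + 0 ≤ shape p (shape p 0 - shape p 1) := by
  rw [crank, numPartsAboveOnes_eq, ← numOnes_eq]
  split_ifs <;> omega

theorem largestPart_pos_iff {n : ℕ} (p : n.Partition) : 0 < largestPart p ↔ 0 < shape p 0 := by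
  rw [shape, Multiset.countP_pos, largestPart, ← not_iff_not, not_lt, Multiset.sup_le]
  push Not
  rfl

theorem crank_pos_iff {n : ℕ} (p : n.Partition) :
    0 < crank p ↔ shape p 0 - shape p 1 + 1 ≤ shape p (shape p 0 - shape p 1) := by
  rw [crank, numPartsAboveOnes_eq, ← numOnes_eq]
  split_ifs with h
  · rw [h, Nat.cast_pos, largestPart_pos_iff, Nat.zero_add, Nat.succ_le_iff]
  · omega

theorem nonnegCrankCount_eq (n : ℕ) : nonnegCrankCount n = meetCount 0 n := by
  classical
  rw [nonnegCrankCount, meetCount, card_filter_shape n (MeetsDiag 0),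
    ← card_onesBound_eq_card_meetsDiag (Or.inl rfl), ← card_filter_shape]
  exact congrArg Finset.card (Finset.filter_congr fun p _ => crank_nonneg_iff p)

/-- At `n = 1`, the exception in `card_onesBound_eq_card_meetsDiag` is compensated by the convention
`D(1) = 1`. -/
theorem posCrankCount_eq (n : ℕ) : posCrankCount n = meetCount 1 n := by
  classical
  rw [posCrankCount]
  split_ifs with h
  · subst h
    rw [meetCount, Finset.filter_true_of_mem, Finset.card_univ, Fintype.card_unique]
    intro p _
    have := (isShape_shape p).sum_eq
    exact ⟨0, by simpa using this⟩
  · rw [meetCount, card_filter_shape n (MeetsDiag 1),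
      ← card_onesBound_eq_card_meetsDiag (Or.inr ⟨rfl, h⟩), ← card_filter_shape]
    exact congrArg Finset.card (Finset.filter_congr fun p _ => crank_pos_iff p)

theorem meetCount_add (s n : ℕ) :
    meetCount s (n + s) + meetCount (s + 1) n = Fintype.card n.Partition := by
  classical
  rw [meetCount, card_filter_shape (n + s) (MeetsDiag s), card_meetsDiag_shift,
    ← card_filter_shape n fun f => ¬ MeetsDiag (s + 1) f, meetCount, add_comm,
    Finset.card_filter_add_card_filter_not, Finset.card_univ]

theorem meetCount_eq_zero {s n : ℕ} (h : n < s) : meetCount s n = 0 := by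
  classical
  refine Finset.card_eq_zero.2 (Finset.filter_eq_empty_iff.2 fun p _ ⟨d, hd⟩ => ?_)
  have hp := isShape_shape p
  have h1 := hp.anti (Nat.zero_le d)
  have h2 := hp.sum_range_eq n.le_succ
  rw [Finset.sum_range_succ'] at h2
  omega

theorem atInt_natCast (f : ℕ → ℕ) (n : ℕ) : atInt f n = f n := by
  simp [atInt]

theorem atInt_of_neg (f : ℕ → ℕ) {x : ℤ} (hx : x < 0) : atInt f x = 0 :=
  if_neg (not_le.2 hx)

/-- The number of partitions of `n`. -/
def partitionCount (n : ℕ) : ℕ := Fintype.card n.Partition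

theorem atInt_meetCount (s : ℕ) (x : ℤ) :
    atInt (meetCount s) x
      = atInt partitionCount (x - s) - atInt (meetCount (s + 1)) (x - s) := by
  rcases lt_or_ge x s with h | h
  · rw [atInt_of_neg _ (show x - s < 0 by omega), atInt_of_neg _ (show x - s < 0 by omega)]
    rcases lt_or_ge x 0 with h0 | h0
    · rw [atInt_of_neg _ h0, sub_zero]
    · lift x to ℕ using h0
      rw [atInt_natCast, meetCount_eq_zero (by omega), Nat.cast_zero, sub_zero]
  · obtain ⟨n, rfl⟩ : ∃ n : ℕ, x = (n : ℤ) + s := ⟨(x - s).toNat, by omega⟩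
    rw [add_sub_cancel_right, ← Nat.cast_add, atInt_natCast, atInt_natCast, atInt_natCast,
      partitionCount, ← meetCount_add s n]
    push_cast
    ring

/-! ### Iterating the recurrence -/

theorem triangle_succ (j : ℕ) : (j + 1) * (j + 1 + 1) / 2 = j * (j + 1) / 2 + (j + 1) := by
  rw [show (j + 1) * (j + 1 + 1) = j * (j + 1) + (j + 1) * 2 by ring,
    Nat.add_mul_div_right _ _ two_pos]

/-- The recurrence `atInt_meetCount`, iterated; the successive shifts `0, 1, …, N` add up to the
triangular number `N * (N + 1) / 2`. -/
theorem atInt_meetCount_zero_eq_sum_add (x : ℤ) (N : ℕ) :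
    atInt (meetCount 0) x
      = ∑ j ∈ Finset.range (N + 1),
          (-1) ^ j * atInt partitionCount (x - ((j * (j + 1) / 2 : ℕ) : ℤ))
        + (-1) ^ (N + 1) * atInt (meetCount (N + 1)) (x - ((N * (N + 1) / 2 : ℕ) : ℤ)) := by
  induction N with
  | zero =>
    rw [atInt_meetCount]
    simp
    ring
  | succ N ih =>
    rw [ih, Finset.sum_range_succ _ (N + 1), atInt_meetCount, triangle_succ]
    push_cast
    rw [sub_sub]
    ring

theorem atInt_meetCount_eq_zero {s : ℕ} {x : ℤ} (h : x < s) : atInt (meetCount s) x = 0 := by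
  rw [atInt_meetCount, atInt_of_neg _ (by omega), atInt_of_neg _ (by omega), sub_zero]

theorem atInt_nonnegCrankCount {x : ℤ} {N : ℕ} (hN : x < N) :
    atInt nonnegCrankCount x
      = ∑ j ∈ Finset.range N,
          (-1) ^ j * atInt partitionCount (x - ((j * (j + 1) / 2 : ℕ) : ℤ)) := by
  rw [show nonnegCrankCount = meetCount 0 from funext nonnegCrankCount_eq]
  cases N with
  | zero => simpa using atInt_of_neg _ hN
  | succ N =>
    rw [atInt_meetCount_zero_eq_sum_add x N, atInt_meetCount_eq_zero (s := N + 1) (by omega),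
      mul_zero, add_zero]

theorem atInt_posCrankCount (x : ℤ) :
    atInt posCrankCount x = atInt partitionCount x - atInt nonnegCrankCount x := by
  rw [show nonnegCrankCount = meetCount 0 from funext nonnegCrankCount_eq,
    show posCrankCount = meetCount 1 from funext posCrankCount_eq, atInt_meetCount 0]
  simp

/-! ### Sums of parts in a residue class -/

theorem card_filter_mem_parts {n a : ℕ} (ha : 0 < a) (han : a ≤ n) :
    (Finset.univ.filter fun p : n.Partition => a ∈ p.parts).card = partitionCount (n - a) := by
  rw [partitionCount, ← Finset.card_univ]
  symm
  refine Finset.card_nbij (fun q => ⟨a ::ₘ q.parts, fun {b} hb => ?_, ?_⟩) ?_ ?_ ?_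
  · rcases Multiset.mem_cons.1 hb with rfl | hb
    · exact ha
    · exact q.parts_pos hb
  · rw [Multiset.sum_cons, q.parts_sum, Nat.add_sub_cancel' han]
  · intro q _
    simp
  · intro q _ q' _ h
    exact Nat.Partition.ext ((Multiset.cons_inj_right a).1 (congrArg Nat.Partition.parts h))
  · intro p hp
    have hp' : a ∈ p.parts := by simpa using hp
    have hs : a + (p.parts.erase a).sum = n := by
      rw [← Multiset.sum_cons, Multiset.cons_erase hp', p.parts_sum]
    exact ⟨⟨p.parts.erase a, fun hb => p.parts_pos (Multiset.mem_of_mem_erase hb), by omega⟩,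
      Finset.mem_coe.2 (Finset.mem_univ _), Nat.Partition.ext (Multiset.cons_erase hp')⟩

/-- Count the pairs of a partition and one of its different parts `m * i + r`. For `m * i + r = 0`
the number of partitions is irrelevant, as it is multiplied by `0`. -/
theorem atInt_residuePartSum {m r : ℕ} (hr : r < m) {x : ℤ} {N : ℕ} (hN : x < N) :
    atInt (residuePartSum m r) x
      = ∑ i ∈ Finset.range N,
          ((m : ℤ) * i + r) * atInt partitionCount (x - m * i - r) := by
  have hm : ∀ i : ℕ, i ≤ m * i := fun i => Nat.le_mul_of_pos_left i (by omega)
  rcases lt_or_ge x 0 with h0 | h0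
  · rw [atInt_of_neg _ h0, Finset.sum_eq_zero]
    intro i _
    rw [atInt_of_neg _ (by have := hm i; zify at this; omega), mul_zero]
  lift x to ℕ using h0
  rw [atInt_natCast, residuePartSum]
  have key : ∀ p : x.Partition, ∑ a ∈ p.parts.toFinset with a ≡ r [MOD m], a
      = ∑ i ∈ Finset.range N, if m * i + r ∈ p.parts then m * i + r else 0 := by
    intro p
    rw [← Finset.sum_filter]
    symm
    refine Finset.sum_nbij (fun i => m * i + r) ?_ ?_ ?_ fun _ _ => rfl
    · intro i hi
      simp only [Finset.mem_filter, Multiset.mem_toFinset] at hi ⊢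
      refine ⟨hi.2, ?_⟩
      simp [Nat.ModEq]
    · intro i _ j _ hij
      have : m * i = m * j := by simpa using hij
      exact Nat.eq_of_mul_eq_mul_left (by omega) this
    · intro a ha
      simp only [Finset.coe_filter, Multiset.mem_toFinset, Set.mem_ofPred_eq] at ha
      have hmod : a % m = r := Eq.trans ha.2 (Nat.mod_eq_of_lt hr)
      have hdiv := Nat.div_add_mod a m
      rw [hmod] at hdiv
      refine ⟨a / m, ?_, hdiv⟩
      simp only [Finset.coe_filter, Finset.mem_range, Set.mem_ofPred_eq, hdiv]
      have := part_le p ha.1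
      have := Nat.div_le_self a m
      exact ⟨by omega, ha.1⟩
  rw [Finset.sum_congr rfl fun p _ => key p, Finset.sum_comm, Nat.cast_sum]
  refine Finset.sum_congr rfl fun i _ => ?_
  rw [← Finset.sum_filter, Finset.sum_const, smul_eq_mul, mul_comm]
  push_cast
  rcases Nat.eq_zero_or_pos (m * i + r) with h | h
  · zify at h
    rw [h, zero_mul, zero_mul]
  congr 1
  rcases le_or_gt (m * i + r) x with hle | hlt
  · rw [card_filter_mem_parts h hle, ← atInt_natCast, Nat.cast_sub hle]
    congr 1
    push_cast
    ring
  · rw [atInt_of_neg _ (by zify at hlt; omega), Finset.filter_false_of_mem, Finset.card_empty,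
      Nat.cast_zero]
    exact fun p _ hp => absurd (part_le p hp) (by omega)

end CrankIdentity

open CrankIdentity

theorem mainTheorem11 (m n r : ℕ) (hr : r < m) :
    (∑ᶠ j : ℕ, (-1 : ℤ) ^ j *
        CrankIdentity.atInt (CrankIdentity.residuePartSum m r)
          ((n : ℤ) - ((j * (j + 1) / 2 : ℕ) : ℤ))
      = ∑ᶠ j : ℕ, ((m : ℤ) * (j : ℤ) + (r : ℤ)) *
          CrankIdentity.atInt CrankIdentity.nonnegCrankCount
            ((n : ℤ) - (m : ℤ) * (j : ℤ) - (r : ℤ))) ∧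
    (∑ᶠ (j : ℕ) (_ : 1 ≤ j), (-1 : ℤ) ^ (j + 1) *
        CrankIdentity.atInt (CrankIdentity.residuePartSum m r)
          ((n : ℤ) - ((j * (j + 1) / 2 : ℕ) : ℤ))
      = ∑ᶠ j : ℕ, ((m : ℤ) * (j : ℤ) + (r : ℤ)) *
          CrankIdentity.atInt CrankIdentity.posCrankCount
            ((n : ℤ) - (m : ℤ) * (j : ℤ) - (r : ℤ))) := by
  have hT : ∀ j : ℕ, j ≤ j * (j + 1) / 2 := by
    intro j
    induction j with
    | zero => exact le_rfl
    | succ j _ => rw [triangle_succ]; omega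
  have hm : ∀ i : ℕ, (i : ℤ) ≤ (m : ℤ) * i := fun i => by
    exact_mod_cast Nat.le_mul_of_pos_left i (by omega)
  have hfin : ∀ g : ℕ → ℤ, (∀ j, n < j → g j = 0) →
      ∑ᶠ j, g j = ∑ j ∈ Finset.range (n + 1), g j := by
    intro g hg
    refine finsum_eq_sum_of_support_subset _ fun j hj => ?_
    by_contra h
    exact hj (hg j (by simpa using h))
  have hL : ∀ j : ℕ, n < j →
      atInt (residuePartSum m r) ((n : ℤ) - ((j * (j + 1) / 2 : ℕ) : ℤ)) = 0 := fun j hj =>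
    atInt_of_neg _ (by have := hT j; omega)
  have hR : ∀ (f : ℕ → ℕ) (j : ℕ), n < j →
      ((m : ℤ) * (j : ℤ) + (r : ℤ)) * atInt f ((n : ℤ) - (m : ℤ) * (j : ℤ) - (r : ℤ)) = 0 :=
    fun f j hj => by rw [atInt_of_neg _ (by have := hm j; omega), mul_zero]
  have h1 : ∑ j ∈ Finset.range (n + 1), (-1 : ℤ) ^ j *
        atInt (residuePartSum m r) ((n : ℤ) - ((j * (j + 1) / 2 : ℕ) : ℤ))
      = ∑ j ∈ Finset.range (n + 1), ((m : ℤ) * (j : ℤ) + (r : ℤ)) *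
          atInt nonnegCrankCount ((n : ℤ) - (m : ℤ) * (j : ℤ) - (r : ℤ)) := by
    rw [Finset.sum_congr rfl fun (j : ℕ) _ => by
        rw [atInt_residuePartSum hr (N := n + 1) (by omega), Finset.mul_sum],
      Finset.sum_comm]
    refine Finset.sum_congr rfl fun i _ => ?_
    rw [atInt_nonnegCrankCount (N := n + 1) (by have := hm i; omega), Finset.mul_sum]
    refine Finset.sum_congr rfl fun j _ => ?_
    rw [sub_right_comm _ _ ((m : ℤ) * i), sub_right_comm _ _ (r : ℤ)]
    ring
  refine ⟨by rw [hfin _ fun j hj => by rw [hL j hj, mul_zero], hfin _ (hR _), h1], ?_⟩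
  -- The second identity is the difference of the expansion of `residuePartSum` at `n`, which is the
  -- term `j = 0`, and the first identity.
  rw [hfin _ (hR _), hfin]
  · simp only [atInt_posCrankCount, mul_sub, Finset.sum_sub_distrib]
    rw [← h1, ← atInt_residuePartSum hr (by omega), Finset.sum_range_succ',
      Finset.sum_range_succ' (fun j : ℕ => (-1 : ℤ) ^ j * _)]
    simp [pow_succ]
  · intro j hj
    rw [hL j hj, mul_zero, finsum_zero]
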